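/- **Theorem (SyncPCN provides endpoint privacy).** Fix a finite payment channel network with parties $\{1,\dots,n\}$, channel balances, forwarding fees and channel timelock values (all public non-negative integers). Let $(\mathrm{Gen},E,\mathrm{Dec})$ be an IND-CCA secure public-key encryption scheme, and let $\mathcal H=(\mathcal H_\kappa)$ be an efficiently computable family of additive homomorphisms from finite abelian groups $\mathbb G_\kappa$ to abelian groups, where $\kappa$ is the security parameter and elements of $\mathbb G_\kappa$ can be sampled in polynomial time, uniformly up to negligible statistical distance. (No one-wayness of $\mathcal H$ is required.) *Payloads.* For a payment of value $v$ along a path $(P_0,\dots,P_k)$ of distinct parties, let $f_m$ be the fee of $P_m$ for forwarding to $P_{m+1}$, let $TL_m$ be the timelock value of the channel from $P_m$ to $P_{m+1}$, and put $v_j=v+\sum_{m=j+1}^{k-1}f_m$ and $T_j=\sum_{m=j+1}^{k-1}TL_m$. All balances on the path must suffice, i.e. $P_j$ has at least $v_j$ coins in its channel with $P_{j+1}$. The sender $P_0$ draws independent random $\ell_0,\dots,\ell_{k-1}\in\mathbb G_\kappa$, puts $y_j=\sum_{m=0}^{j}\ell_m$ and $Y_j=\mathcal H_\kappa(y_j)$,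 and forms the onion $$M_j=\bigl(P_{j+1},\,v_j,\,(Y_{j-1},Y_j,\ell_j),\,T_j,\,E_{pk_{j+1}}(M_{j+1})\bigr)\quad(1\le j<k),\qquad M_k=(v_{k-1},Y_{k-1},T_{k-1}),$$ where $pk_u$ denotes the public key of party $P_u$ and every $M_j$ is padded so that its length depends only on $\kappa$ and on the number $k-j$ of remaining hops (this length is computable in polynomial time, and sufficient for every payment in the network). *Endpoint privacy game.* All parties generate their keys honestly. The adversary is a party $a$; it receives $1^\kappa$, all public keys and its own secret key. It selects a value $v$, a position $i$ and two paths $(P_0^b,\dots,P_k^b)$, $b\in\{0,1\}$, of the same number $k>i\ge1$ of channels, both admitting a payment of value $v$ as above, such that $P_i^0=P_i^1=a$, $P_{i-1}^0=P_{i-1}^1$, $P_{i+1}^0=P_{i+1}^1$, $(P_0^0,P_k^0)\ne(P_0^1,P_k^1)$, and such that the amount $v_i$ and the timelock $T_i$ are the same for both payments. A uniformly random bit $b$ is drawn and the payment along path $b$ is set up. The adversary receives its payload $M_i^b$, together with the conditional payment $(v_{i-1},Y_{i-1},T_{i-1})$ locked for it and the witness $y_i$ that it learns when the payment succeeds, and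 it outputs a bit $b'$. It wins if $b'=b$. *Claim.* For every party $a$ and every probabilistic polynomial-time adversary that always makes an allowed choice, $\Pr[b'=b]=\tfrac12+\varepsilon(\kappa)$ with $\varepsilon$ negligible. -/

import Mathlib

noncomputable section

/-! ### Data: finite binary trees -/

/-- All messages, keys and ciphertexts are finite binary trees ("S-expressions").  A tree with `s`
internal nodes is the same thing as a bit string of length `2 * s + 1` (its preorder code). -/
inductive Data : Type
  | leaf : Data
  | node : Data → Data → Data
  deriving DecidableEq

namespace Data

/-- The length of a datum: its number of internal nodes. -/
def size : Data → ℕ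
  | leaf => 0
  | node a b => 1 + a.size + b.size

def fst : Data → Data
  | leaf => leaf
  | node a _ => a

def snd : Data → Data
  | leaf => leaf
  | node _ b => b

/-- A tuple, as a list `a₁ :: ⋯ :: aₘ :: nil`. -/
def ofList : List Data → Data
  | [] => leaf
  | a :: t => node a (ofList t)

/-- The number `m` in unary: a list of `m` leaves, of size `m`. -/
def unary : ℕ → Data
  | 0 => leaf
  | m + 1 => node leaf (unary m)

def ofBool : Bool → Data
  | false => leaf
  | true => node leaf leaf

def toBool : Data → Bool
  | leaf => false
  | node _ _ => true

/-- The number `m` in binary. -/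
def ofNat (m : ℕ) : Data := ofList ((Nat.bits m).map ofBool)

/-- The number of entries of a datum read as a list. -/
def length : Data → ℕ
  | leaf => 0
  | node _ b => b.length + 1

/-- `m` followed by as many blanks as needed to reach size `w + 1`
(which is possible if and only if `m.size ≤ w`). -/
def pad (w : ℕ) (m : Data) : Data := node m (unary (w - m.size))

theorem ofList_injective : Function.Injective ofList := by
  intro l₁
  induction l₁ with
  | nil => intro l₂ h; cases l₂ <;> simp_all [ofList]
  | cons a t ih =>
    intro l₂ h
    cases l₂ with
    | nil => simp [ofList] at h
    | cons b s =>
      simp only [ofList, node.injEq] at h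
      rw [h.1, ih h.2]

theorem ofBool_injective : Function.Injective ofBool := by
  intro a b h
  cases a <;> cases b <;> simp_all [ofBool]

theorem bits_injective : Function.Injective Nat.bits := by
  intro a b h
  apply Nat.eq_of_testBit_eq
  intro i
  rw [Nat.testBit_eq_inth, Nat.testBit_eq_inth, h]

theorem ofNat_injective : Function.Injective ofNat := by
  intro a b h
  exact bits_injective (List.map_injective_iff.2 ofBool_injective (ofList_injective h))

end Data

/-! ### Probabilistic programs with a step count -/

/-- A fair coin. -/
def coin : PMF Bool := PMF.uniformOfFintype Bool

/-- Programs of a probabilistic machine that works on binary trees.  `Q` is the set of names of the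
oracles that a program may call (`Q = Empty`: no oracle).  All loops are bounded (`loop f` repeats
`f` once for each entry of a list), so every program halts.  Polynomial time loses nothing by
this: a polynomial-time machine can be run for as many rounds as its polynomial clock shows. -/
inductive Prog (Q : Type) : Type
  | ident : Prog Q
  | nil : Prog Q
  | fst : Prog Q
  | snd : Prog Q
  /-- run both programs on the same input and pair the results -/
  | pair : Prog Q → Prog Q → Prog Q
  /-- `comp g f` runs `f` first and `g` on its result -/
  | comp : Prog Q → Prog Q → Prog Q
  /-- `ite c f g` runs `c`; then runs `f` or `g` on the original input -/
  | ite : Prog Q → Prog Q → Prog Q → Prog Q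
  /-- on input `(a, x)`, apply the program to `x` as many times as `a` has entries -/
  | loop : Prog Q → Prog Q
  /-- test the two components of the input for equality -/
  | eq : Prog Q
  /-- the size of the input, in unary -/
  | size : Prog Q
  /-- toss a fair coin -/
  | coin : Prog Q
  | oracle : Q → Prog Q

namespace Prog

/-- `m`-fold repetition of a randomised step, with the total cost. -/
def iterate (step : Data → PMF (Data × ℕ)) : ℕ → Data → PMF (Data × ℕ)
  | 0, x => pure (x, 0)
  | m + 1, x => do
    let y ← step x
    let z ← iterate step m y.1
    pure (z.1, y.2 + z.2)

/-- Joint law of the output and of the running time.  Every executed instruction is charged one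
plus the size of the datum that it reads, and a call of an oracle also for the answer.
So the cost bounds the size of all data that occur, and it agrees with the running time of a
probabilistic Turing machine up to a polynomial. -/
def eval {Q : Type} (O : Q → Data → PMF Data) : Prog Q → Data → PMF (Data × ℕ)
  | ident, x => pure (x, 1 + x.size)
  | nil, x => pure (Data.leaf, 1 + x.size)
  | fst, x => pure (x.fst, 1 + x.size)
  | snd, x => pure (x.snd, 1 + x.size)
  | pair f g, x => do
    let y ← eval O f x
    let z ← eval O g x
    pure (Data.node y.1 z.1, y.2 + z.2 + (1 + x.size))
  | comp g f, x => do
    let y ← eval O f x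
    let z ← eval O g y.1
    pure (z.1, y.2 + z.2 + (1 + x.size))
  | ite c f g, x => do
    let y ← eval O c x
    let z ← (if y.1.toBool then eval O f x else eval O g x)
    pure (z.1, y.2 + z.2 + (1 + x.size))
  | loop f, x => do
    let z ← iterate (eval O f) x.fst.length x.snd
    pure (z.1, z.2 + (1 + x.size))
  | eq, x => pure (Data.ofBool (decide (x.fst = x.snd)), 1 + x.size)
  | size, x => pure (Data.unary x.size, 1 + x.size)
  | coin, x => do
    let b ← _root_.coin
    pure (Data.ofBool b, 1 + x.size)
  | oracle q, x => do
    let y ← O q x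
    pure (y, 1 + x.size + y.size)

/-- The law of the output. -/
def runWith {Q : Type} (O : Q → Data → PMF Data) (c : Prog Q) (x : Data) : PMF Data := do
  let y ← c.eval O x
  pure y.1

/-- Whatever the coins, `c` halts on `x` within time `t`. -/
def RunsWithin {Q : Type} (O : Q → Data → PMF Data) (c : Prog Q) (x : Data) (t : ℕ) : Prop :=
  ∀ o ∈ (c.eval O x).support, o.2 ≤ t

def noOracle : Empty → Data → PMF Data := fun q => q.elim

def run (c : Prog Empty) (x : Data) : PMF Data := c.runWith noOracle x

/-- Probabilistic polynomial time. -/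
def PolyTime (c : Prog Empty) : Prop :=
  ∃ p : Polynomial ℕ, ∀ x : Data, c.RunsWithin noOracle x (p.eval x.size)

end Prog

/-- Negligible functions: `κ ^ d * ε κ → 0` for every `d`. -/
def Negligible (ε : ℕ → ℝ) : Prop :=
  Asymptotics.SuperpolynomialDecay Filter.atTop (fun κ : ℕ => (κ : ℝ)) ε

/-! ### Public-key encryption and IND-CCA security -/

/-- A public-key encryption scheme.  `gen` maps `1^κ` to a pair (public key, secret key), `enc` maps
(public key, message) to a ciphertext, and `dec` maps (secret key, ciphertext) to `node leaf m`
for a message `m`, or to `leaf` if the ciphertext is rejected. -/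
structure PKE where
  gen : Prog Empty
  enc : Prog Empty
  dec : Prog Empty
  gen_polyTime : gen.PolyTime
  enc_polyTime : enc.PolyTime
  dec_polyTime : dec.PolyTime
  /-- decryption inverts encryption up to a negligible error -/
  correct : ∀ q : Polynomial ℕ, ∃ ε : ℕ → ℝ, Negligible ε ∧
    ∀ (κ : ℕ) (m : Data), m.size ≤ q.eval κ →
      ((do
        let k ← gen.run (Data.unary κ)
        let c ← enc.run (Data.node k.fst m)
        let d ← dec.run (Data.node k.snd c)
        pure (decide (d ≠ Data.node Data.leaf m)) : PMF Bool) true).toReal ≤ ε κ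

namespace PKE

variable (E : PKE)

/-- A fresh key pair (public key, secret key). -/
def keyGen (κ : ℕ) : PMF (Data × Data) := do
  let k ← E.gen.run (Data.unary κ)
  pure (k.fst, k.snd)

def encrypt (pk m : Data) : PMF Data := E.enc.run (Data.node pk m)

/-- The decryption oracle, which rejects the ciphertext `ch` if there is one. -/
def decOracle (sk : Data) (ch : Option Data) : Unit → Data → PMF Data := fun _ c =>
  if ch = some c then pure Data.leaf else E.dec.run (Data.node sk c)

/-- A two-stage adversary with a decryption oracle.  `choose` maps `(1^κ, pk)` to
`((m₀, m₁), state)`, and `guess` maps `(state, challenge ciphertext)` to a bit. -/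
structure Adversary where
  choose : Prog Unit
  guess : Prog Unit

/-- The adversary runs in probabilistic polynomial time. -/
def Adversary.PPT (A : Adversary) : Prop :=
  ∃ p : Polynomial ℕ, ∀ (κ : ℕ), ∀ k ∈ (E.keyGen κ).support, ∀ (ch : Option Data) (x : Data),
    A.choose.RunsWithin (E.decOracle k.2 ch) x (p.eval (κ + x.size)) ∧
    A.guess.RunsWithin (E.decOracle k.2 ch) x (p.eval (κ + x.size))

/-- The two messages that the adversary submits always have the same length. -/
def Adversary.EqualLength (A : Adversary) : Prop :=
  ∀ (κ : ℕ), ∀ k ∈ (E.keyGen κ).support,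
    ∀ o ∈ (A.choose.runWith (E.decOracle k.2 none) (Data.node (Data.unary κ) k.1)).support,
      o.fst.fst.size = o.fst.snd.size

/-- The IND-CCA game (decryption queries before and after the challenge); the outcome is `true`
if the adversary wins. -/
def ccaGame (A : Adversary) (κ : ℕ) : PMF Bool := do
  let k ← E.keyGen κ
  let o ← A.choose.runWith (E.decOracle k.2 none) (Data.node (Data.unary κ) k.1)
  let b ← coin
  let c ← E.encrypt k.1 (if b then o.fst.snd else o.fst.fst)
  let g ← A.guess.runWith (E.decOracle k.2 (some c)) (Data.node o.snd c)
  pure (decide (g.toBool = b))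

/-- IND-CCA security: every admissible PPT adversary wins with probability `1/2 + ε`,
`ε` negligible. -/
def INDCCA : Prop :=
  ∀ A : Adversary, A.PPT E → A.EqualLength E →
    Negligible fun κ => (E.ccaGame A κ true).toReal - 1 / 2

end PKE

/-! ### Additively homomorphic functions -/

/-- An efficiently computable family of additively homomorphic functions `hash κ : Dom κ → Ran κ` on
finite abelian groups, whose domain can be sampled (almost) uniformly in polynomial time. -/
structure HomFunction where
  Dom : ℕ → Type
  Ran : ℕ → Type
  [domGroup : ∀ κ, AddCommGroup (Dom κ)]
  [domFintype : ∀ κ, Fintype (Dom κ)]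
  [ranGroup : ∀ κ, AddCommGroup (Ran κ)]
  hash : ∀ κ, Dom κ →+ Ran κ
  /-- representation of the elements of the two groups by data -/
  encDom : ∀ κ, Dom κ ↪ Data
  encRan : ∀ κ, Ran κ ↪ Data
  /-- the law of a random element, at negligible statistical distance from the uniform law -/
  rand : ∀ κ, PMF (Dom κ)
  rand_uniform : Negligible fun κ =>
    (∑ x : Dom κ, |(rand κ x).toReal - 1 / (Fintype.card (Dom κ) : ℝ)|) / 2
  randProg : Prog Empty
  addProg : Prog Empty
  hashProg : Prog Empty
  randProg_polyTime : randProg.PolyTime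
  addProg_polyTime : addProg.PolyTime
  hashProg_polyTime : hashProg.PolyTime
  randProg_run : ∀ κ, randProg.run (Data.unary κ) = (rand κ).map (encDom κ)
  addProg_run : ∀ κ (x y : Dom κ),
    addProg.run (Data.ofList [Data.unary κ, encDom κ x, encDom κ y]) =
      PMF.pure (encDom κ (x + y))
  hashProg_run : ∀ κ (x : Dom κ),
    hashProg.run (Data.ofList [Data.unary κ, encDom κ x]) = PMF.pure (encRan κ (hash κ x))

attribute [instance] HomFunction.domGroup HomFunction.domFintype HomFunction.ranGroup

/-! ### Payment channel networks and multi-hop payments -/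

/-- A payment channel network with parties `Fin n`.  `balance u w` is the number of coins that `u`
can pay to `w` in their channel, `fee u w` is the fee of `u` for forwarding a payment to `w`, and
`timelock u w` is the timelock value of the channel for payments from `u` to `w`. -/
structure Network (n : ℕ) where
  channels : SimpleGraph (Fin n)
  balance : Fin n → Fin n → ℕ
  fee : Fin n → Fin n → ℕ
  timelock : Fin n → Fin n → ℕ

namespace Network

variable {n : ℕ} (N : Network n)

/-- `v_j = v + ∑_{m = j+1}^{k-1} f_m`: the amount paid from `P j` to `P (j+1)` in a payment of value
`v` along `P 0, …, P k`. -/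
def amount (P : ℕ → Fin n) (k v j : ℕ) : ℕ :=
  v + ∑ m ∈ Finset.Ico (j + 1) k, N.fee (P m) (P (m + 1))

/-- `T_j = ∑_{m = j+1}^{k-1} TL_m`. -/
def lockTime (P : ℕ → Fin n) (k j : ℕ) : ℕ :=
  ∑ m ∈ Finset.Ico (j + 1) k, N.timelock (P m) (P (m + 1))

/-- `P 0, …, P k` is a path of `k` channels between distinct parties, with sufficient balances for
a payment of value `v`. -/
def IsPayment (P : ℕ → Fin n) (k v : ℕ) : Prop :=
  Set.InjOn P (Set.Iic k) ∧
  ∀ j < k, N.channels.Adj (P j) (P (j + 1)) ∧ N.amount P k v j ≤ N.balance (P j) (P (j + 1))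

end Network

/-! ### The protocol -/

/-- The ingredients of the protocol: a payment channel network, an encryption scheme, an additively
homomorphic function and the padding.  `width κ r` is the length to which the payload of a party
that is `r` hops away from the receiver is padded; it can be computed in polynomial time. -/
structure SyncPCN (n : ℕ) where
  net : Network n
  pke : PKE
  hom : HomFunction
  width : ℕ → ℕ → ℕ
  widthProg : Prog Empty
  widthProg_polyTime : widthProg.PolyTime
  widthProg_run : ∀ κ r, widthProg.run (Data.node (Data.unary κ) (Data.unary r)) =
    PMF.pure (Data.unary (width κ r))

/-- `m` independent draws from `p`, in the entries `0, …, m-1`; the other entries are `d`. -/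
def iid {α : Type} (p : PMF α) (d : α) : ℕ → PMF (ℕ → α)
  | 0 => pure fun _ => d
  | m + 1 => do
    let f ← iid p d m
    let x ← p
    pure (Function.update f m x)

namespace SyncPCN

variable {n : ℕ} (S : SyncPCN n)

/-- `y_j = ∑_{i=0}^{j} ℓ_i`. -/
def witness (κ : ℕ) (l : ℕ → S.hom.Dom κ) (j : ℕ) : S.hom.Dom κ :=
  ∑ i ∈ Finset.range (j + 1), l i

/-- `Y_j = H(y_j)`, as a datum. -/
def condition (κ : ℕ) (l : ℕ → S.hom.Dom κ) (j : ℕ) : Data :=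
  S.hom.encRan κ (S.hom.hash κ (S.witness κ l j))

/-- The conditional payment `CP_j = (v_j, Y_j, T_j)` from `P j` to `P (j+1)`. -/
def condPayment (κ : ℕ) (P : ℕ → Fin n) (k v : ℕ) (l : ℕ → S.hom.Dom κ) (j : ℕ) : Data :=
  Data.ofList [Data.ofNat (S.net.amount P k v j), S.condition κ l j,
    Data.ofNat (S.net.lockTime P k j)]

/-- The payload message `M_j` of `P j`, as the sender constructs it, where `j = k - r` for the number
`r` of hops from `P j` to the receiver `P k`.  For an intermediary,
`M_j = (P_{j+1}, v_j, (Y_{j-1}, Y_j, ℓ_j), T_j, E_{pk_{j+1}}(M_{j+1}))`; the receiver has no next hop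
and `M_k` holds the conditional payment `CP_{k-1}`.  All payloads are padded. -/
def payload (κ : ℕ) (pk : Fin n → Data) (P : ℕ → Fin n) (k v : ℕ) (l : ℕ → S.hom.Dom κ) :
    ℕ → PMF Data
  | 0 => pure (Data.pad (S.width κ 0) (S.condPayment κ P k v l (k - 1)))
  | r + 1 => do
    let j := k - (r + 1)
    let M ← payload κ pk P k v l r
    let C ← S.pke.encrypt (pk (P (j + 1))) M
    pure (Data.pad (S.width κ (r + 1)) (Data.ofList
      [Data.ofNat (P (j + 1)),
       Data.ofNat (S.net.amount P k v j),
       Data.ofList [S.condition κ l (j - 1), S.condition κ l j, S.hom.encDom κ (l j)],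
       Data.ofNat (S.net.lockTime P k j),
       C]))

/-- The padding does what it is meant to do: in every payment, the payload of a party that is `r`
hops away from the receiver has the length that is prescribed by `κ` and `r`. -/
def PaddingSuffices : Prop :=
  ∀ (κ : ℕ) (keys : Fin n → Data × Data) (P : ℕ → Fin n) (k v : ℕ) (l : ℕ → S.hom.Dom κ),
    (∀ u, keys u ∈ (S.pke.keyGen κ).support) → S.net.IsPayment P k v →
    (∀ j < k, l j ∈ (S.hom.rand κ).support) →
    ∀ r < k, ∀ M ∈ (S.payload κ (fun u => (keys u).1) P k v l r).support,
      M.size = S.width κ r + 1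

/-- What an intermediary `P i` learns in a successful payment: the conditional payment `CP_{i-1}`
that is locked for it, its payload `M_i`, and the witness `y_i`. -/
def intermediaryView (κ : ℕ) (pk : Fin n → Data) (P : ℕ → Fin n) (k v i : ℕ) : PMF Data := do
  let l ← iid (S.hom.rand κ) 0 k
  let M ← S.payload κ pk P k v l (k - i)
  pure (Data.ofList [S.condPayment κ P k v l (i - 1), M, S.hom.encDom κ (S.witness κ l i)])

/-! ### Endpoint privacy -/

/-- What the adversary selects: two paths, its position on both, and the payment value. -/
structure Choice (n : ℕ) where
  path₀ : List (Fin n)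
  path₁ : List (Fin n)
  pos : ℕ
  value : ℕ

namespace Choice

def path {n : ℕ} (ch : Choice n) (b : Bool) : List (Fin n) := if b then ch.path₁ else ch.path₀

/-- The number of channels of the paths. -/
def hops {n : ℕ} (ch : Choice n) : ℕ := ch.path₀.length - 1

/-- The `j`-th party on the path (`a` beyond the end of the path). -/
def party {n : ℕ} (ch : Choice n) (a : Fin n) (b : Bool) (j : ℕ) : Fin n := (ch.path b).getD j a

def encodePath {n : ℕ} (L : List (Fin n)) : Data := Data.ofList (L.map fun u : Fin n => Data.ofNat (u : ℕ))

def encode {n : ℕ} (ch : Choice n) : Data :=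
  Data.ofList [encodePath ch.path₀, encodePath ch.path₁, Data.ofNat ch.pos, Data.ofNat ch.value]

theorem encodePath_injective {n : ℕ} : Function.Injective (encodePath (n := n)) := by
  intro a b h
  have hf : Function.Injective fun u : Fin n => Data.ofNat (u : ℕ) := fun u w huw =>
    Fin.ext (Data.ofNat_injective huw)
  exact List.map_injective_iff.2 hf (Data.ofList_injective h)

theorem encode_injective {n : ℕ} : Function.Injective (encode (n := n)) := by
  rintro ⟨a, b, c, d⟩ ⟨a', b', c', d'⟩ h
  have h' := Data.ofList_injective h
  simp only [List.cons.injEq, and_true] at h'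
  obtain ⟨h1, h2, h3, h4⟩ := h'
  rw [encodePath_injective h1, encodePath_injective h2, Data.ofNat_injective h3,
    Data.ofNat_injective h4]

open Classical in
/-- The partial inverse of `encode`. -/
def decode {n : ℕ} (y : Data) : Option (Choice n) :=
  if h : ∃ ch : Choice n, ch.encode = y then some h.choose else none

theorem decode_encode {n : ℕ} (ch : Choice n) : decode ch.encode = some ch := by
  have h : ∃ ch' : Choice n, ch'.encode = ch.encode := ⟨ch, rfl⟩
  simp only [decode, dif_pos h, Option.some.injEq]
  exact encode_injective h.choose_spec

end Choice

/-- The choices that the game allows to the adversary `a`: two payments of the same value along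
paths of the same length, with `a` as intermediary at the same position and the same two
neighbours, with different pairs of endpoints, and with the same amount and timelock at `a`. -/
structure ValidChoice (a : Fin n) (ch : Choice n) : Prop where
  length_eq : ∀ b, (ch.path b).length = ch.hops + 1
  payment : ∀ b, S.net.IsPayment (ch.party a b) ch.hops ch.value
  pos_pos : 1 ≤ ch.pos
  pos_lt : ch.pos < ch.hops
  self : ∀ b, ch.party a b ch.pos = a
  pred_eq : ch.party a false (ch.pos - 1) = ch.party a true (ch.pos - 1)
  succ_eq : ch.party a false (ch.pos + 1) = ch.party a true (ch.pos + 1)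
  endpoints_ne : (ch.party a false 0, ch.party a false ch.hops) ≠
    (ch.party a true 0, ch.party a true ch.hops)
  amount_eq : S.net.amount (ch.party a false) ch.hops ch.value ch.pos =
    S.net.amount (ch.party a true) ch.hops ch.value ch.pos
  lockTime_eq : S.net.lockTime (ch.party a false) ch.hops ch.pos =
    S.net.lockTime (ch.party a true) ch.hops ch.pos

/-- `choose` maps `(1^κ, all public keys, the secret key of the adversary)` to (encoded choice, state),
and `guess` maps `(state, view)` to a bit. -/
structure Adversary where
  choose : Prog Empty
  guess : Prog Empty

def Adversary.PPT (A : Adversary) : Prop := A.choose.PolyTime ∧ A.guess.PolyTime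

/-- The input of the adversary `a`. -/
def advInput (κ : ℕ) (a : Fin n) (keys : Fin n → Data × Data) : Data :=
  Data.ofList [Data.unary κ, Data.ofList (List.ofFn fun u => (keys u).1), (keys a).2]

/-- The adversary always makes a choice that the game allows. -/
def Adversary.Admissible (a : Fin n) (A : Adversary) : Prop :=
  ∀ (κ : ℕ) (keys : Fin n → Data × Data), (∀ u, keys u ∈ (S.pke.keyGen κ).support) →
    ∀ o ∈ (A.choose.run (advInput κ a keys)).support,
      ∃ ch : Choice n, o.fst = ch.encode ∧ S.ValidChoice a ch

/-- What the adversary `a` sees if it has submitted `y` as its choice and the bit `b` is drawn.  (The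
case `none` does not occur for admissible adversaries.) -/
def gameView (κ : ℕ) (a : Fin n) (pk : Fin n → Data) (b : Bool) (y : Data) : PMF Data :=
  match (Choice.decode y : Option (Choice n)) with
  | none => pure Data.leaf
  | some ch => S.intermediaryView κ pk (ch.party a b) ch.hops ch.value ch.pos

/-- The endpoint privacy game for the adversary `a`; the outcome is `true` if `a` wins. -/
def endpointGame (a : Fin n) (A : Adversary) (κ : ℕ) : PMF Bool := do
  let ks ← iid (S.pke.keyGen κ) (Data.leaf, Data.leaf) n
  let keys : Fin n → Data × Data := fun u => ks u
  let o ← A.choose.run (advInput κ a keys)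
  let b ← coin
  let view ← S.gameView κ a (fun u => (keys u).1) b o.fst
  let g ← A.guess.run (Data.node o.snd view)
  pure (decide (g.toBool = b))

/-- Endpoint privacy: every PPT adversary wins the game with probability `1/2 + ε`, `ε` negligible. -/
def EndpointPrivacy : Prop :=
  ∀ (a : Fin n) (A : Adversary), A.PPT → A.Admissible S a →
    Negligible fun κ => (S.endpointGame a A κ true).toReal - 1 / 2

end SyncPCN

end

/-! Fix the choice of the adversary `a`. The fee and the timelock of its own channel to the next hop
are the same on both paths, so equality of `v_i` and `T_i` gives equality of `v_{i-1}` and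
`T_{i-1}`. The shares have the same law for both bits. Hence the bit enters the view only through
the ciphertext for the next hop (`ValidChoice.viewOf_eq`, `ValidChoice.intermediaryView_eq`). That
hop is not `a`, and padding gives the two possible plaintexts equal length, so telling them apart is
an attack on the encryption scheme.

The attacker on the scheme must fix the owner of the challenge key before `a` chooses. The network
is fixed and finite, so only finitely many choices are valid (`finite_validChoice`), and each one
gets its own attacker with that choice hard-wired. This attacker plants the challenge key at the
next hop and runs `a`. If `a` makes the hard-wired choice, it continues the game with the challenge
ciphertext; otherwise it tosses a coin (`exists_reduction`). In every run exactly one attacker plays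
the real game and all others win with probability exactly `1 / 2`, so the advantage of `a` is the
sum of the advantages of the attackers (`sum_advantage`, `advantage_eq_sum`): a fixed finite sum of
negligible functions.

Most of the remaining work shows that these attackers run in polynomial time, by closure properties
of `Efficient`. -/

noncomputable section

/-! ### Sizes and lengths of data -/

namespace Data

@[simp] theorem fst_node (a b : Data) : (node a b).fst = a := rfl
@[simp] theorem snd_node (a b : Data) : (node a b).snd = b := rfl

theorem size_fst_le (x : Data) : x.fst.size ≤ x.size := by
  cases x <;> simp only [fst, size] <;> omega

theorem size_snd_le (x : Data) : x.snd.size ≤ x.size := by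
  cases x <;> simp only [snd, size] <;> omega

@[simp] theorem size_unary (m : ℕ) : (unary m).size = m := by
  induction m with
  | zero => rfl
  | succ m ih => simp only [unary, size, ih]; omega

@[simp] theorem length_unary (m : ℕ) : (unary m).length = m := by
  induction m with
  | zero => rfl
  | succ m ih => simp only [unary, length, ih]

theorem length_le_size (x : Data) : x.length ≤ x.size := by
  induction x with
  | leaf => simp [length]
  | node a b _ ih => simp only [length, size]; omega

theorem snd_unary (m : ℕ) : (unary m).snd = unary (m - 1) := by
  cases m <;> rfl

theorem snd_iterate_unary (m w : ℕ) : snd^[m] (unary w) = unary (w - m) := by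
  induction m generalizing w with
  | zero => rfl
  | succ m ih => rw [Function.iterate_succ_apply, snd_unary, ih, Nat.sub_sub, Nat.add_comm 1 m]

@[simp] theorem toBool_ofBool (b : Bool) : (ofBool b).toBool = b := by cases b <;> rfl

end Data

theorem Polynomial.eval_nat_mono (p : Polynomial ℕ) : Monotone fun m => p.eval m := by
  intro a b h
  simp only [Polynomial.eval_eq_sum, Polynomial.sum]
  gcongr

/-! ### Running times, and programs that ignore their oracle -/

namespace Prog

variable {Q : Type} (O : Q → Data → PMF Data)

/-- The summand `x.size` covers zero rounds, which cost nothing and return `x`; `loop` pays for it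
with its own charge. -/
theorem size_le_of_mem_support_iterate {step : Data → PMF (Data × ℕ)}
    (h : ∀ x, ∀ o ∈ (step x).support, o.1.size ≤ o.2) (m : ℕ) (x : Data) :
    ∀ o ∈ (iterate step m x).support, o.1.size ≤ x.size + o.2 := by
  induction m generalizing x with
  | zero =>
    rintro o ho
    obtain rfl := (PMF.mem_support_pure_iff _ _).1 ho
    simp
  | succ m ih =>
    rintro o ho
    obtain ⟨y, hy, ho⟩ := (PMF.mem_support_bind_iff _ _ _).1 ho
    obtain ⟨z, hz, ho⟩ := (PMF.mem_support_bind_iff _ _ _).1 ho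
    obtain rfl := (PMF.mem_support_pure_iff _ _).1 ho
    have h1 := h x y hy
    have h2 := ih y.1 z hz
    simp only
    omega

/-- The running time bounds the size of the output. -/
theorem size_le_cost (c : Prog Q) (x : Data) :
    ∀ o ∈ (c.eval O x).support, o.1.size ≤ o.2 := by
  induction c generalizing x with
  | ident =>
    rintro o ho
    obtain rfl := (PMF.mem_support_pure_iff _ _).1 ho
    simp
  | nil =>
    rintro o ho
    obtain rfl := (PMF.mem_support_pure_iff _ _).1 ho
    simp [Data.size]
  | fst =>
    rintro o ho
    obtain rfl := (PMF.mem_support_pure_iff _ _).1 ho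
    have := x.size_fst_le
    simp only; omega
  | snd =>
    rintro o ho
    obtain rfl := (PMF.mem_support_pure_iff _ _).1 ho
    have := x.size_snd_le
    simp only; omega
  | pair f g ihf ihg =>
    rintro o ho
    obtain ⟨y, hy, ho⟩ := (PMF.mem_support_bind_iff _ _ _).1 ho
    obtain ⟨z, hz, ho⟩ := (PMF.mem_support_bind_iff _ _ _).1 ho
    obtain rfl := (PMF.mem_support_pure_iff _ _).1 ho
    have h1 := ihf x y hy
    have h2 := ihg x z hz
    simp only [Data.size]; omega
  | comp g f ihg ihf =>
    rintro o ho
    obtain ⟨y, hy, ho⟩ := (PMF.mem_support_bind_iff _ _ _).1 ho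
    obtain ⟨z, hz, ho⟩ := (PMF.mem_support_bind_iff _ _ _).1 ho
    obtain rfl := (PMF.mem_support_pure_iff _ _).1 ho
    have h2 := ihg y.1 z hz
    simp only; omega
  | ite c f g ihc ihf ihg =>
    rintro o ho
    obtain ⟨y, hy, ho⟩ := (PMF.mem_support_bind_iff _ _ _).1 ho
    obtain ⟨z, hz, ho⟩ := (PMF.mem_support_bind_iff _ _ _).1 ho
    obtain rfl := (PMF.mem_support_pure_iff _ _).1 ho
    have h2 : z.1.size ≤ z.2 := by
      split_ifs at hz
      · exact ihf x z hz
      · exact ihg x z hz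
    simp only; omega
  | loop f ih =>
    rintro o ho
    obtain ⟨z, hz, ho⟩ := (PMF.mem_support_bind_iff _ _ _).1 ho
    obtain rfl := (PMF.mem_support_pure_iff _ _).1 ho
    have h1 := size_le_of_mem_support_iterate ih _ _ z hz
    have h2 := x.size_snd_le
    simp only; omega
  | eq =>
    rintro o ho
    obtain rfl := (PMF.mem_support_pure_iff _ _).1 ho
    cases decide (x.fst = x.snd) <;> simp [Data.ofBool, Data.size]
  | size =>
    rintro o ho
    obtain rfl := (PMF.mem_support_pure_iff _ _).1 ho
    simp
  | coin =>
    rintro o ho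
    obtain ⟨b, hb, ho⟩ := (PMF.mem_support_bind_iff _ _ _).1 ho
    obtain rfl := (PMF.mem_support_pure_iff _ _).1 ho
    cases b <;> simp [Data.ofBool, Data.size]
  | oracle q =>
    rintro o ho
    obtain ⟨y, hy, ho⟩ := (PMF.mem_support_bind_iff _ _ _).1 ho
    obtain rfl := (PMF.mem_support_pure_iff _ _).1 ho
    simp

/-- A program without oracle calls, as a program with oracles. -/
def lift : Prog Empty → Prog Q
  | ident => ident
  | nil => nil
  | fst => fst
  | snd => snd
  | pair f g => pair f.lift g.lift
  | comp g f => comp g.lift f.lift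
  | ite c f g => ite c.lift f.lift g.lift
  | loop f => loop f.lift
  | eq => eq
  | size => size
  | coin => coin
  | oracle q => q.elim

theorem eval_lift (c : Prog Empty) : (c.lift : Prog Q).eval O = c.eval noOracle := by
  induction c with
  | pair f g ihf ihg => funext x; simp only [lift, eval, ihf, ihg]
  | comp g f ihg ihf => funext x; simp only [lift, eval, ihf, ihg]
  | ite c f g ihc ihf ihg => funext x; simp only [lift, eval, ihc, ihf, ihg]
  | loop f ih => funext x; simp only [lift, eval, ih]
  | oracle q => exact q.elim
  | _ => rfl

theorem runWith_lift (c : Prog Empty) (x : Data) : (c.lift : Prog Q).runWith O x = c.run x := by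
  simp only [run, runWith, eval_lift]

/-- The polynomial does not depend on the oracle, because a lifted program never calls it. The slack
`κ` gives the bound the shape required by `PKE.Adversary.PPT`. -/
theorem PolyTime.runsWithin_lift {c : Prog Empty} (h : c.PolyTime) :
    ∃ p : Polynomial ℕ, ∀ (O : Q → Data → PMF Data) (κ : ℕ) (x : Data),
      (c.lift : Prog Q).RunsWithin O x (p.eval (κ + x.size)) := by
  obtain ⟨p, hp⟩ := h
  refine ⟨p, fun O κ x o ho => ?_⟩
  rw [eval_lift] at ho
  exact (hp x o ho).trans (p.eval_nat_mono (Nat.le_add_left _ _))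

/-! ### Laws of the outputs -/

theorem run_ident (x : Data) : ident.run x = PMF.pure x := PMF.pure_bind _ _
theorem run_nil (x : Data) : nil.run x = PMF.pure Data.leaf := PMF.pure_bind _ _
theorem run_fst (x : Data) : fst.run x = PMF.pure x.fst := PMF.pure_bind _ _
theorem run_snd (x : Data) : snd.run x = PMF.pure x.snd := PMF.pure_bind _ _
theorem run_size (x : Data) : size.run x = PMF.pure (Data.unary x.size) := PMF.pure_bind _ _
theorem run_eq (x : Data) : eq.run x = PMF.pure (Data.ofBool (decide (x.fst = x.snd))) :=
  PMF.pure_bind _ _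

theorem run_coin (x : Data) : coin.run x = _root_.coin.bind fun b => PMF.pure (Data.ofBool b) := by
  change (PMF.bind (PMF.bind _ _) _) = _
  rw [PMF.bind_bind]
  congr 1; funext b
  exact PMF.pure_bind _ _

theorem run_pair (f g : Prog Empty) (x : Data) : (pair f g).run x =
    (f.run x).bind fun y => (g.run x).bind fun z => PMF.pure (Data.node y z) := by
  simp only [run, runWith, eval, Bind.bind, Pure.pure, PMF.bind_bind, PMF.pure_bind]

theorem run_comp (g f : Prog Empty) (x : Data) :
    (comp g f).run x = (f.run x).bind fun y => g.run y := by
  simp only [run, runWith, eval, Bind.bind, Pure.pure, PMF.bind_bind, PMF.pure_bind]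

theorem run_ite (c f g : Prog Empty) (x : Data) : (ite c f g).run x =
    (c.run x).bind fun y => if y.toBool then f.run x else g.run x := by
  simp only [run, runWith, eval, Bind.bind, Pure.pure, PMF.bind_bind, PMF.pure_bind]
  congr 1; funext y
  split_ifs <;> rfl

/-! ### Polynomial time -/

theorem polyTime_of_eval_eq {c : Prog Empty} (f : Data → Data)
    (h : ∀ x, c.eval noOracle x = PMF.pure (f x, 1 + x.size)) : c.PolyTime := by
  refine ⟨1 + Polynomial.X, fun x o ho => ?_⟩
  rw [h] at ho
  obtain rfl := (PMF.mem_support_pure_iff _ _).1 ho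
  simp

theorem polyTime_ident : PolyTime ident := polyTime_of_eval_eq _ fun _ => rfl
theorem polyTime_nil : PolyTime nil := polyTime_of_eval_eq _ fun _ => rfl
theorem polyTime_fst : PolyTime fst := polyTime_of_eval_eq _ fun _ => rfl
theorem polyTime_snd : PolyTime snd := polyTime_of_eval_eq _ fun _ => rfl
theorem polyTime_size : PolyTime size := polyTime_of_eval_eq _ fun _ => rfl
theorem polyTime_eq : PolyTime eq := polyTime_of_eval_eq _ fun _ => rfl

theorem polyTime_coin : PolyTime coin := by
  refine ⟨1 + Polynomial.X, fun x o ho => ?_⟩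
  obtain ⟨b, hb, ho⟩ := (PMF.mem_support_bind_iff _ _ _).1 ho
  obtain rfl := (PMF.mem_support_pure_iff _ _).1 ho
  simp

theorem PolyTime.pair {f g : Prog Empty} (hf : f.PolyTime) (hg : g.PolyTime) :
    (pair f g).PolyTime := by
  obtain ⟨p, hp⟩ := hf
  obtain ⟨q, hq⟩ := hg
  refine ⟨p + q + (1 + Polynomial.X), fun x o ho => ?_⟩
  obtain ⟨y, hy, ho⟩ := (PMF.mem_support_bind_iff _ _ _).1 ho
  obtain ⟨z, hz, ho⟩ := (PMF.mem_support_bind_iff _ _ _).1 ho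
  obtain rfl := (PMF.mem_support_pure_iff _ _).1 ho
  have h1 := hp x y hy
  have h2 := hq x z hz
  simp only [Polynomial.eval_add, Polynomial.eval_one, Polynomial.eval_X]
  omega

theorem PolyTime.comp {f g : Prog Empty} (hg : g.PolyTime) (hf : f.PolyTime) :
    (comp g f).PolyTime := by
  obtain ⟨p, hp⟩ := hf
  obtain ⟨q, hq⟩ := hg
  refine ⟨p + q.comp p + (1 + Polynomial.X), fun x o ho => ?_⟩
  obtain ⟨y, hy, ho⟩ := (PMF.mem_support_bind_iff _ _ _).1 ho
  obtain ⟨z, hz, ho⟩ := (PMF.mem_support_bind_iff _ _ _).1 ho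
  obtain rfl := (PMF.mem_support_pure_iff _ _).1 ho
  have h1 := hp x y hy
  -- The intermediate result is no larger than the time spent on producing it.
  have h2 : z.2 ≤ q.eval (p.eval x.size) := (hq y.1 z hz).trans (q.eval_nat_mono ((size_le_cost _ f x y hy).trans h1))
  simp only [Polynomial.eval_add, Polynomial.eval_one, Polynomial.eval_X, Polynomial.eval_comp]
  omega

theorem PolyTime.ite {c f g : Prog Empty} (hc : c.PolyTime) (hf : f.PolyTime) (hg : g.PolyTime) :
    (ite c f g).PolyTime := by
  obtain ⟨p, hp⟩ := hc
  obtain ⟨q, hq⟩ := hf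
  obtain ⟨r, hr⟩ := hg
  refine ⟨p + q + r + (1 + Polynomial.X), fun x o ho => ?_⟩
  obtain ⟨y, hy, ho⟩ := (PMF.mem_support_bind_iff _ _ _).1 ho
  obtain ⟨z, hz, ho⟩ := (PMF.mem_support_bind_iff _ _ _).1 ho
  obtain rfl := (PMF.mem_support_pure_iff _ _).1 ho
  have h1 := hp x y hy
  have h2 : z.2 ≤ q.eval x.size + r.eval x.size := by
    split_ifs at hz
    · exact (hq x z hz).trans (Nat.le_add_right _ _)
    · exact (hr x z hz).trans (Nat.le_add_left _ _)
  simp only [Polynomial.eval_add, Polynomial.eval_one, Polynomial.eval_X]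
  omega

/-- Removing the first entries of a list takes time at most quadratic in the input. -/
theorem exists_iterate_snd (m : ℕ) (x : Data) : ∃ t ≤ m * (1 + x.size),
    iterate (eval noOracle snd) m x = PMF.pure (Data.snd^[m] x, t) := by
  induction m generalizing x with
  | zero => exact ⟨0, le_rfl.trans (Nat.zero_le _), rfl⟩
  | succ m ih =>
    obtain ⟨t, ht, h⟩ := ih x.snd
    refine ⟨1 + x.size + t, ?_, ?_⟩
    · have := Nat.mul_le_mul_left m (Nat.add_le_add_left x.size_snd_le 1)
      rw [Nat.succ_mul]
      omega
    · change PMF.bind (PMF.pure _) _ = _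
      rw [PMF.pure_bind]
      change PMF.bind (iterate _ m x.snd) _ = _
      rw [h, PMF.pure_bind]
      rfl

theorem run_loop_snd (x : Data) : (loop snd).run x = PMF.pure (Data.snd^[x.fst.length] x.snd) := by
  obtain ⟨t, -, h⟩ := exists_iterate_snd x.fst.length x.snd
  change PMF.bind (PMF.bind (iterate (eval noOracle snd) x.fst.length x.snd) _) _ = _
  rw [h, PMF.pure_bind]
  exact PMF.pure_bind _ _

/-- Loops need not preserve polynomial time, since a datum may double in each round. Here it never
grows, and this one loop is all that padding needs. -/
theorem polyTime_loop_snd : PolyTime (loop snd) := by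
  refine ⟨Polynomial.X * (1 + Polynomial.X) + (1 + Polynomial.X), fun x o ho => ?_⟩
  obtain ⟨t, ht, h⟩ := exists_iterate_snd x.fst.length x.snd
  obtain ⟨z, hz, ho⟩ := (PMF.mem_support_bind_iff _ _ _).1 ho
  obtain rfl := (PMF.mem_support_pure_iff _ _).1 ho
  rw [h] at hz
  obtain rfl := (PMF.mem_support_pure_iff _ _).1 hz
  have h1 : x.fst.length * (1 + x.snd.size) ≤ x.size * (1 + x.size) :=
    Nat.mul_le_mul (x.fst.length_le_size.trans x.size_fst_le)
      (Nat.add_le_add_left x.size_snd_le 1)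
  simp only [Polynomial.eval_add, Polynomial.eval_one, Polynomial.eval_X, Polynomial.eval_mul]
  omega

end Prog

/-! ### Efficiently computable random functions -/

/-- The random function `f` of an input in `α`, encoded by `e`, is computed by a probabilistic
polynomial-time program. -/
def Efficient {α : Type} (e : α → Data) (f : α → PMF Data) : Prop :=
  ∃ c : Prog Empty, c.PolyTime ∧ ∀ x, c.run (e x) = f x

/-- The function `g` of an input in `α`, encoded by `e`, is computed by a polynomial-time program. -/
abbrev EfficientFun {α : Type} (e : α → Data) (g : α → Data) : Prop :=
  Efficient e fun x => PMF.pure (g x)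

section Efficient

variable {α β : Type} {e : α → Data}

theorem EfficientFun.run {g : α → Data} (hg : EfficientFun e g) {c : Prog Empty} (hc : c.PolyTime) :
    Efficient e fun x => c.run (g x) := by
  obtain ⟨d, hd, h⟩ := hg
  exact ⟨c.comp d, hc.comp hd, fun x => by rw [Prog.run_comp, h, PMF.pure_bind]⟩

theorem efficientFun_self : EfficientFun e e := ⟨.ident, Prog.polyTime_ident, fun _ => Prog.run_ident _⟩

theorem Efficient.congr {f f' : α → PMF Data} (h : Efficient e f) (hf : ∀ x, f x = f' x) :
    Efficient e f' := by
  obtain rfl : f = f' := funext hf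
  exact h

theorem EfficientFun.fst {g : α → Data} (hg : EfficientFun e g) : EfficientFun e fun x => (g x).fst :=
  (hg.run Prog.polyTime_fst).congr fun _ => Prog.run_fst _

theorem EfficientFun.snd {g : α → Data} (hg : EfficientFun e g) : EfficientFun e fun x => (g x).snd :=
  (hg.run Prog.polyTime_snd).congr fun _ => Prog.run_snd _

theorem EfficientFun.size {g : α → Data} (hg : EfficientFun e g) :
    EfficientFun e fun x => Data.unary (g x).size :=
  (hg.run Prog.polyTime_size).congr fun _ => Prog.run_size _

theorem EfficientFun.node {g h : α → Data} (hg : EfficientFun e g) (hh : EfficientFun e h) :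
    EfficientFun e fun x => Data.node (g x) (h x) := by
  obtain ⟨c, hc, hg⟩ := hg
  obtain ⟨d, hd, hh⟩ := hh
  exact ⟨c.pair d, hc.pair hd, fun x => by
    rw [Prog.run_pair, hg, hh, PMF.pure_bind, PMF.pure_bind]⟩

/-- This is what hard-wires a choice: its paths, amounts and timelocks become part of the program.
-/
theorem efficientFun_const (y : Data) : EfficientFun e fun _ => y := by
  induction y with
  | leaf => exact (efficientFun_self.run Prog.polyTime_nil).congr fun _ => Prog.run_nil _
  | node a b iha ihb => exact iha.node ihb

theorem EfficientFun.ofList {gs : List (α → Data)} (h : ∀ g ∈ gs, EfficientFun e g) :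
    EfficientFun e fun x => Data.ofList (gs.map fun g => g x) := by
  induction gs with
  | nil => exact efficientFun_const _
  | cons g gs ih =>
    exact (h g (by simp)).node (ih fun g' hg' => h g' (by simp [hg']))

theorem EfficientFun.eq {g h : α → Data} (hg : EfficientFun e g) (hh : EfficientFun e h) :
    EfficientFun e fun x => Data.ofBool (decide (g x = h x)) :=
  ((hg.node hh).run Prog.polyTime_eq).congr fun _ => Prog.run_eq _

/-- Dropping as many entries of the unary number `w` as the size of `m`. -/
theorem EfficientFun.pad {w : α → ℕ} {m : α → Data} (hw : EfficientFun e fun x => Data.unary (w x))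
    (hm : EfficientFun e m) : EfficientFun e fun x => Data.pad (w x) (m x) := by
  refine hm.node (((hm.size.node hw).run Prog.polyTime_loop_snd).congr fun x => ?_)
  rw [Prog.run_loop_snd]
  simp only [Data.fst, Data.snd, Data.length_unary, Data.snd_iterate_unary]

theorem EfficientFun.ite {t : α → Data} {f g : α → PMF Data} (ht : EfficientFun e t)
    (hf : Efficient e f) (hg : Efficient e g) :
    Efficient e fun x => if (t x).toBool then f x else g x := by
  obtain ⟨c, hc, ht⟩ := ht
  obtain ⟨p, hp, hf⟩ := hf
  obtain ⟨q, hq, hg⟩ := hg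
  exact ⟨c.ite p q, hc.ite hp hq, fun x => by rw [Prog.run_ite, ht, PMF.pure_bind, hf, hg]⟩

/-- A function of a part of the context. -/
theorem Efficient.reindex {f : α → PMF Data} (hf : Efficient e f) {e' : β → Data} (φ : β → α)
    (h : EfficientFun e' fun z => e (φ z)) : Efficient e' fun z => f (φ z) := by
  obtain ⟨c, hc, hf⟩ := hf
  exact (h.run hc).congr fun z => hf _

/-- The encoding of a context that is extended by a new item. -/
def extend (e : α → Data) {β : α → Type} (e' : ∀ x, β x → Data) (z : Σ x, β x) : Data :=
  Data.node (e' z.1 z.2) (e z.1)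

theorem efficientFun_extend_fst {β : α → Type} {e' : ∀ x, β x → Data} :
    EfficientFun (extend e e') fun z => e' z.1 z.2 := efficientFun_self.fst

theorem Efficient.extend {β : α → Type} {e' : ∀ x, β x → Data} {f : α → PMF Data}
    (hf : Efficient e f) : Efficient (extend e e') fun z => f z.1 :=
  hf.reindex Sigma.fst efficientFun_self.snd

theorem EfficientFun.extend {β : α → Type} {e' : ∀ x, β x → Data} {g : α → Data}
    (hg : EfficientFun e g) : EfficientFun (_root_.extend e e') fun z => g z.1 :=
  Efficient.extend hg

/-- The program keeps a copy of its input next to the sample, so the continuation sees both. The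
type `β x` varies with the context because shares live in `Dom κ`. -/
theorem Efficient.bind {β : α → Type} {p : ∀ x, PMF (β x)} {e' : ∀ x, β x → Data}
    {g : ∀ x, β x → PMF Data} (hp : Efficient e fun x => (p x).map (e' x))
    (hg : Efficient (_root_.extend e e') fun z => g z.1 z.2) :
    Efficient e fun x => (p x).bind (g x) := by
  obtain ⟨c, hc, hp⟩ := hp
  obtain ⟨d, hd, hg⟩ := hg
  refine ⟨d.comp (c.pair .ident), hd.comp (hc.pair Prog.polyTime_ident), fun x => ?_⟩
  simp only [Prog.run_comp, Prog.run_pair, Prog.run_ident, hp, PMF.bind_bind, PMF.pure_bind,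
    PMF.bind_map, Function.comp_def]
  congr 1; funext y
  exact hg ⟨x, y⟩

theorem Efficient.bindData {p : α → PMF Data} {g : α → Data → PMF Data} (hp : Efficient e p)
    (hg : Efficient (_root_.extend e fun _ (y : Data) => y) fun z => g z.1 z.2) :
    Efficient e fun x => (p x).bind (g x) :=
  Efficient.bind (e' := fun _ y => y) (hp.congr fun _ => (PMF.map_id _).symm) hg

end Efficient

/-! ### Independent samples -/

section iid

variable {α : Type}

theorem mem_support_of_mem_support_iid {p : PMF α} {d : α} {m : ℕ} {f : ℕ → α}
    (hf : f ∈ (iid p d m).support) {j : ℕ} (hj : j < m) : f j ∈ p.support := by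
  induction m generalizing f with
  | zero => omega
  | succ m ih =>
    obtain ⟨g, hg, hf⟩ := (PMF.mem_support_bind_iff _ _ _).1 hf
    obtain ⟨x, hx, hf⟩ := (PMF.mem_support_bind_iff _ _ _).1 hf
    obtain rfl := (PMF.mem_support_pure_iff _ _).1 hf
    by_cases h : j = m
    · subst h; simpa using hx
    · rw [Function.update_of_ne h]
      exact ih hg (by omega)

/-- One of several independent samples can be drawn anew. -/
theorem iid_resample (p : PMF α) (d : α) {m u : ℕ} (hu : u < m) :
    iid p d m = p.bind fun x => (iid p d m).bind fun f => PMF.pure (Function.update f u x) := by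
  induction m with
  | zero => omega
  | succ m ih =>
    have hs : iid p d (m + 1) = (iid p d m).bind fun f => p.bind fun x =>
      PMF.pure (Function.update f m x) := rfl
    by_cases h : u = m
    · subst h
      rw [hs]
      -- The old last sample is overwritten and integrates out.
      simp only [PMF.bind_bind, PMF.pure_bind, Function.update_idem, PMF.bind_const]
      exact PMF.bind_comm _ _ _
    · rw [hs]
      simp only [PMF.bind_bind, PMF.pure_bind]
      conv_lhs => rw [ih (by omega)]
      simp only [PMF.bind_bind, PMF.pure_bind]
      congr 1; funext x; congr 1; funext f; congr 1; funext y
      rw [Function.update_comm (Ne.symm h)]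

/-- The encoding of the first `m` entries of a sequence. -/
def encodeVec (e : α → Data) (f : ℕ → α) : ℕ → Data
  | 0 => Data.leaf
  | m + 1 => Data.node (e (f m)) (encodeVec e f m)

theorem encodeVec_update (e : α → Data) (f : ℕ → α) (x : α) {m u : ℕ} (h : m ≤ u) :
    encodeVec e (Function.update f u x) m = encodeVec e f m := by
  induction m with
  | zero => rfl
  | succ m ih => rw [encodeVec, encodeVec, ih (by omega), Function.update_of_ne (by omega)]

variable {γ : Type} {e : γ → Data}

theorem EfficientFun.entry {β : γ → Type} {e' : ∀ x, β x → Data} {f : ∀ x, ℕ → β x} {m j : ℕ}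
    (hf : EfficientFun e fun x => encodeVec (e' x) (f x) m) (hj : j < m) :
    EfficientFun e fun x => e' x (f x j) := by
  induction m with
  | zero => omega
  | succ m ih =>
    by_cases h : j = m
    · subst h; exact hf.fst
    · exact ih hf.snd (by omega)

theorem Efficient.iid {β : γ → Type} {e' : ∀ x, β x → Data} {p : ∀ x, PMF (β x)}
    (hp : Efficient e fun x => (p x).map (e' x)) (d : ∀ x, β x) (m : ℕ) :
    Efficient e fun x => (_root_.iid (p x) (d x) m).map fun f => encodeVec (e' x) f m := by
  induction m with
  | zero =>
    refine (efficientFun_const Data.leaf).congr fun x => ?_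
    rw [show _root_.iid (p x) (d x) 0 = PMF.pure fun _ => d x from rfl, PMF.pure_map]
    rfl
  | succ m ih =>
    refine (ih.bindData (g := fun x v => (p x).bind fun y => PMF.pure (Data.node (e' x y) v))
      (Efficient.bind (e' := fun (z : Σ _ : γ, Data) => e' z.1) hp.extend
        (efficientFun_extend_fst.node efficientFun_extend_fst.extend))).congr fun x => ?_
    simp only [_root_.iid, Bind.bind, Pure.pure, PMF.bind_map, PMF.map_bind, PMF.pure_map,
      encodeVec, Function.update_self, encodeVec_update _ _ _ le_rfl]
    rfl

end iid

/-! ### Programs for the protocol -/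

theorem PKE.efficient_keyGen (E : PKE) {α : Type} {e : α → Data} {κ : α → ℕ}
    (hκ : EfficientFun e fun x => Data.unary (κ x)) :
    Efficient e fun x => (E.keyGen (κ x)).map fun p => Data.node p.1 p.2 := by
  refine ((hκ.run E.gen_polyTime).bindData (g := fun _ y => PMF.pure (Data.node y.fst y.snd))
    (efficientFun_extend_fst.fst.node efficientFun_extend_fst.snd)).congr fun x => ?_
  simp only [PKE.keyGen, Bind.bind, Pure.pure, PMF.map_bind, PMF.pure_map]

namespace SyncPCN

variable {n : ℕ} (S : SyncPCN n)

section Programs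

variable {α : Type} {e : α → Data} {κ : α → ℕ} {l : ∀ x, ℕ → S.hom.Dom (κ x)} {k : ℕ}

theorem efficient_witness (hκ : EfficientFun e fun x => Data.unary (κ x))
    (hl : ∀ j < k, EfficientFun e fun x => S.hom.encDom (κ x) (l x j)) {j : ℕ} (hj : j < k) :
    EfficientFun e fun x => S.hom.encDom (κ x) (S.witness (κ x) (l x) j) := by
  induction j with
  | zero => exact (hl 0 hj).congr fun x => by simp [witness]
  | succ j ih =>
    refine ((hκ.node ((ih (by omega)).node ((hl (j + 1) hj).node
      (efficientFun_const Data.leaf)))).run S.hom.addProg_polyTime).congr fun x => ?_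
    beta_reduce
    rw [show S.witness (κ x) (l x) (j + 1) = S.witness (κ x) (l x) j + l x (j + 1) from
      Finset.sum_range_succ _ _]
    exact S.hom.addProg_run _ _ _

theorem efficient_condition (hκ : EfficientFun e fun x => Data.unary (κ x))
    (hl : ∀ j < k, EfficientFun e fun x => S.hom.encDom (κ x) (l x j)) {j : ℕ} (hj : j < k) :
    EfficientFun e fun x => S.condition (κ x) (l x) j :=
  ((hκ.node ((S.efficient_witness hκ hl hj).node (efficientFun_const Data.leaf))).run
    S.hom.hashProg_polyTime).congr fun _ => S.hom.hashProg_run _ _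

theorem efficient_condPayment (hκ : EfficientFun e fun x => Data.unary (κ x))
    (hl : ∀ j < k, EfficientFun e fun x => S.hom.encDom (κ x) (l x j)) (P : ℕ → Fin n) (v : ℕ)
    {j : ℕ} (hj : j < k) : EfficientFun e fun x => S.condPayment (κ x) P k v (l x) j :=
  (efficientFun_const _).node ((S.efficient_condition hκ hl hj).node
    ((efficientFun_const _).node (efficientFun_const _)))

theorem efficient_width (hκ : EfficientFun e fun x => Data.unary (κ x)) (r : ℕ) :
    EfficientFun e fun x => Data.unary (S.width (κ x) r) :=
  ((hκ.node (efficientFun_const _)).run S.widthProg_polyTime).congr fun _ => S.widthProg_run _ _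

/-- The payload of the intermediary `P (k - (r + 1))`, given the ciphertext `C` for the next hop. -/
def layer (κ : ℕ) (P : ℕ → Fin n) (k v : ℕ) (l : ℕ → S.hom.Dom κ) (r : ℕ) (C : Data) : Data :=
  Data.pad (S.width κ (r + 1)) (Data.ofList
    [Data.ofNat (P (k - (r + 1) + 1)), Data.ofNat (S.net.amount P k v (k - (r + 1))),
     Data.ofList [S.condition κ l (k - (r + 1) - 1), S.condition κ l (k - (r + 1)),
       S.hom.encDom κ (l (k - (r + 1)))],
     Data.ofNat (S.net.lockTime P k (k - (r + 1))), C])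

theorem payload_succ (κ : ℕ) (pk : Fin n → Data) (P : ℕ → Fin n) (k v : ℕ) (l : ℕ → S.hom.Dom κ)
    (r : ℕ) : S.payload κ pk P k v l (r + 1) = (S.payload κ pk P k v l r).bind fun M =>
      (S.pke.encrypt (pk (P (k - (r + 1) + 1))) M).bind fun C =>
        PMF.pure (S.layer κ P k v l r C) := rfl

/-- No relation between `r` and `k` is needed: truncated subtraction keeps every index below `k` as
soon as `0 < k`. -/
theorem efficient_layer (hκ : EfficientFun e fun x => Data.unary (κ x))
    (hl : ∀ j < k, EfficientFun e fun x => S.hom.encDom (κ x) (l x j)) (P : ℕ → Fin n) (v : ℕ)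
    (hk : 0 < k) (r : ℕ) {C : α → Data} (hC : EfficientFun e C) :
    EfficientFun e fun x => S.layer (κ x) P k v (l x) r (C x) :=
  (S.efficient_width hκ _).pad
    ((efficientFun_const _).node ((efficientFun_const _).node (EfficientFun.node
      ((S.efficient_condition hκ hl (by omega)).node
        ((S.efficient_condition hκ hl (by omega)).node
          ((hl _ (by omega)).node (efficientFun_const _))))
      ((efficientFun_const _).node (hC.node (efficientFun_const _))))))

/-- As `P`, `k`, `v` and `r` are fixed, the recursion unrolls into one fixed program with `r`
encryptions; the polynomial may depend on them. -/
theorem efficient_payload {pk : α → Fin n → Data}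
    (hκ : EfficientFun e fun x => Data.unary (κ x)) (hpk : ∀ u, EfficientFun e fun x => pk x u)
    (hl : ∀ j < k, EfficientFun e fun x => S.hom.encDom (κ x) (l x j)) (P : ℕ → Fin n) (v : ℕ)
    (hk : 0 < k) (r : ℕ) : Efficient e fun x => S.payload (κ x) (pk x) P k v (l x) r := by
  induction r with
  | zero => exact (S.efficient_width hκ 0).pad (S.efficient_condPayment hκ hl P v (by omega))
  | succ r ih =>
    simp only [payload_succ]
    refine ih.bindData (Efficient.bindData
      ((EfficientFun.node (EfficientFun.extend (hpk _)) efficientFun_extend_fst).run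
        S.pke.enc_polyTime) ?_)
    exact S.efficient_layer (κ := fun z : Σ _ : (Σ _ : α, Data), Data => κ z.1.1)
      (l := fun z => l z.1.1) (EfficientFun.extend (EfficientFun.extend hκ))
      (fun j hj => EfficientFun.extend (EfficientFun.extend (hl j hj))) P v hk r
      efficientFun_extend_fst

end Programs

/-- Only the secret key of `a` enters, so the input can be built even when another party holds a
foreign public key. -/
theorem efficient_advInput {α : Type} {e : α → Data} {κ : α → ℕ} {keys : α → Fin n → Data × Data}
    (a : Fin n) (hκ : EfficientFun e fun x => Data.unary (κ x))
    (hpk : ∀ u, EfficientFun e fun x => (keys x u).1)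
    (hsk : EfficientFun e fun x => (keys x a).2) :
    EfficientFun e fun x => advInput (κ x) a (keys x) := by
  refine hκ.node (EfficientFun.node ?_ (hsk.node (efficientFun_const _)))
  refine (EfficientFun.ofList (gs := List.ofFn fun u x => (keys x u).1) fun g hg => ?_).congr
    fun x => ?_
  · obtain ⟨u, rfl⟩ := List.mem_ofFn.1 hg
    exact hpk u
  · simp only [List.map_ofFn]
    rfl

end SyncPCN

/-! ### Coin tosses and the addition of advantages -/

/-- The attacker samples both plaintexts, the privacy game only the one selected by the bit; the
other one integrates out. -/
theorem bind_bind_coin {α β : Type} (p₀ p₁ : PMF α) (F : Bool → α → PMF β) :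
    (p₀.bind fun m₀ => p₁.bind fun m₁ => coin.bind fun b => F b (if b then m₁ else m₀)) =
      coin.bind fun b => (if b then p₁ else p₀).bind (F b) := by
  have h : ∀ m₀, (p₁.bind fun m₁ => coin.bind fun b => F b (if b then m₁ else m₀)) =
      coin.bind fun b => p₁.bind fun m₁ => F b (if b then m₁ else m₀) :=
    fun m₀ => PMF.bind_comm _ _ _
  simp only [h]
  rw [PMF.bind_comm]
  congr 1; funext b
  cases b <;> simp

theorem coin_guess_true (p : PMF Data) :
    (coin.bind fun b => p.bind fun _ => coin.bind fun g => PMF.pure (decide (g = b))) true =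
      1 / 2 := by
  simp only [PMF.bind_const]
  have h : ∀ b : Bool, (coin.bind fun g => PMF.pure (decide (g = b))) true = 1 / 2 := by
    intro b
    cases b <;> simp [PMF.bind_apply, tsum_fintype, coin, PMF.pure_apply]
  rw [PMF.bind_apply]
  simp only [h]
  rw [ENNReal.tsum_mul_right, PMF.tsum_coe, one_mul]

/-- If in every case exactly one of several games coincides with a given one and the others are won
with probability `1 / 2`, then the advantages add up. -/
theorem sum_advantage {β ι : Type} (D : PMF β) (R : β → PMF Bool) (L : Finset ι)
    (F : ι → β → PMF Bool)
    (h : ∀ z ∈ D.support, ∃ c ∈ L, F c z = R z ∧ ∀ c' ∈ L, c' ≠ c → F c' z true = 1 / 2) :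
    ((D.bind R) true).toReal - 1 / 2 =
      ∑ c ∈ L, (((D.bind (F c)) true).toReal - 1 / 2) := by
  classical
  have hne : ∀ (p : PMF Bool), p true ≠ ⊤ := fun p => p.apply_ne_top _
  -- Stated additively, because subtraction truncates in `ENNReal`. For each `z` in the support one
  -- summand equals `R z true` and the other `L.card - 1` equal `1 / 2`.
  have key : ∑ c ∈ L, (D.bind (F c)) true + 1 / 2 = (D.bind R) true + L.card * (1 / 2) := by
    have h1 : ∀ t : ENNReal, t = ∑' z, D z * t := fun t => by
      rw [ENNReal.tsum_mul_right, PMF.tsum_coe, one_mul]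
    have h2 : ∑ c ∈ L, (D.bind (F c)) true + 1 / 2 =
        ∑' z, (∑ c ∈ L, D z * F c z true + D z * (1 / 2)) := by
      rw [ENNReal.tsum_add, ← h1, Summable.tsum_finsetSum fun _ _ => ENNReal.summable]
      rfl
    have h3 : (D.bind R) true + L.card * (1 / 2) =
        ∑' z, (D z * R z true + D z * (L.card * (1 / 2))) := by
      rw [ENNReal.tsum_add, ← h1]
      rfl
    rw [h2, h3]
    congr 1; funext z
    by_cases hz : D z = 0
    · simp [hz]
    obtain ⟨c, hc, hR, hF⟩ := h z ((D.mem_support_iff z).2 hz)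
    rw [← Finset.mul_sum, ← mul_add, ← mul_add, ← Finset.add_sum_erase L _ hc, hR,
      Finset.sum_congr rfl fun c' hc' => hF c' (Finset.mem_of_mem_erase hc')
        (Finset.ne_of_mem_erase hc'), Finset.sum_const, nsmul_eq_mul, add_assoc,
      ← add_one_mul, ← Nat.cast_add_one, Finset.card_erase_add_one hc]
  have hreal := congrArg ENNReal.toReal key
  rw [ENNReal.toReal_add (ENNReal.sum_ne_top.2 fun c _ => hne _) (by simp),
    ENNReal.toReal_add (hne _) (ENNReal.mul_ne_top (by simp) (by simp)),
    ENNReal.toReal_sum fun c _ => hne _, ENNReal.toReal_mul] at hreal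
  simp only [ENNReal.toReal_natCast, one_div, ENNReal.toReal_inv, ENNReal.toReal_ofNat] at hreal
  rw [Finset.sum_sub_distrib, Finset.sum_const, nsmul_eq_mul]
  linarith

theorem Negligible.sum {ι : Type} (L : Finset ι) {ε : ι → ℕ → ℝ}
    (h : ∀ c ∈ L, Negligible (ε c)) : Negligible fun κ => ∑ c ∈ L, ε c κ := by
  classical
  induction L using Finset.induction_on with
  | empty => exact Asymptotics.superpolynomialDecay_zero _ _
  | insert c L hc ih =>
    simp only [Finset.sum_insert hc]
    exact Asymptotics.SuperpolynomialDecay.add (h c (by simp))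
      (ih fun c' hc' => h c' (by simp [hc']))

namespace SyncPCN

variable {n : ℕ} (S : SyncPCN n)

/-! ### Valid choices -/

theorem ValidChoice.hops_lt {a : Fin n} {ch : Choice n} (h : S.ValidChoice a ch) :
    ch.hops < n := by
  have := Finset.card_le_card_of_injOn (s := Finset.Iic ch.hops) (t := Finset.univ)
    (ch.party a false) (fun _ _ => Finset.mem_univ _) (by simpa using (h.payment false).1)
  simpa using this

/-- Distinctness of the parties bounds the paths by `n` vertices, and the balance of the first
channel bounds the value. The bounds do not involve `κ`, so the number of attackers is constant. -/
theorem finite_validChoice (a : Fin n) : {ch : Choice n | S.ValidChoice a ch}.Finite := by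
  have hlist : {l : List (Fin n) | l.length ≤ n}.Finite := List.finite_length_le _ _
  let B := ∑ u, ∑ w, S.net.balance u w
  refine ((hlist.prod (hlist.prod ((Set.finite_Iic n).prod (Set.finite_Iic B)))).preimage
    (f := fun ch : Choice n => (ch.path₀, ch.path₁, ch.pos, ch.value)) ?_).subset ?_
  · rintro ⟨x, y, p, v⟩ - ⟨x', y', p', v'⟩ - h
    simpa using h
  · intro ch h
    have hk := h.hops_lt
    have h0 : ch.path₀.length = ch.hops + 1 := h.length_eq false
    have h1 : ch.path₁.length = ch.hops + 1 := h.length_eq true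
    have hpos := h.pos_lt
    refine ⟨?_, ?_, ?_, ?_⟩
    · simp only [Set.mem_ofPred_eq]; omega
    · simp only [Set.mem_ofPred_eq]; omega
    · simp only [Set.mem_Iic]; omega
    · simp only [Set.mem_Iic]
      calc ch.value ≤ S.net.amount (ch.party a false) ch.hops ch.value 0 := Nat.le_add_right _ _
        _ ≤ S.net.balance (ch.party a false 0) (ch.party a false 1) :=
            ((h.payment false).2 0 (by omega)).2
        _ ≤ ∑ w, S.net.balance (ch.party a false 0) w :=
            Finset.single_le_sum (f := fun w => S.net.balance (ch.party a false 0) w)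
              (fun _ _ => Nat.zero_le _) (Finset.mem_univ _)
        _ ≤ B := Finset.single_le_sum (f := fun u => ∑ w, S.net.balance u w)
              (fun _ _ => Nat.zero_le _) (Finset.mem_univ _)

/-- The next hop of the adversary. -/
def Choice.next (a : Fin n) (ch : Choice n) : Fin n := ch.party a false (ch.pos + 1)

/-- The number of hops from the successor of the adversary to the receiver. -/
def Choice.remaining (ch : Choice n) : ℕ := ch.hops - (ch.pos + 1)

namespace ValidChoice

variable {S} {a : Fin n} {ch : Choice n} (h : S.ValidChoice a ch)

include h

theorem remaining_add : ch.hops - ch.pos = ch.remaining + 1 := by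
  have := h.pos_lt
  unfold Choice.remaining
  omega

theorem hops_sub : ch.hops - (ch.remaining + 1) = ch.pos := by
  have := h.pos_lt
  unfold Choice.remaining
  omega

theorem next_eq (b : Bool) : ch.party a b (ch.pos + 1) = ch.next a := by
  cases b
  · rfl
  · exact h.succ_eq.symm

/-- The parties on a path are distinct. Hence `a` does not hold the secret key that belongs to the
challenge. -/
theorem next_ne : ch.next a ≠ a := by
  intro heq
  have hlt := h.pos_lt
  have := (h.payment false).1 (show ch.pos + 1 ≤ ch.hops by omega) (show ch.pos ≤ ch.hops by omega)
    (heq.trans (h.self false).symm)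
  omega

theorem amount_pos (b : Bool) : S.net.amount (ch.party a b) ch.hops ch.value ch.pos =
    S.net.amount (ch.party a false) ch.hops ch.value ch.pos := by
  cases b
  · rfl
  · exact h.amount_eq.symm

theorem lockTime_pos (b : Bool) : S.net.lockTime (ch.party a b) ch.hops ch.pos =
    S.net.lockTime (ch.party a false) ch.hops ch.pos := by
  cases b
  · rfl
  · exact h.lockTime_eq.symm

/-- Both paths leave `a` through the same channel, so the fee that is added does not depend on `b`.
-/
theorem amount_pred (b : Bool) : S.net.amount (ch.party a b) ch.hops ch.value (ch.pos - 1) =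
    S.net.fee a (ch.next a) + S.net.amount (ch.party a b) ch.hops ch.value ch.pos := by
  have h1 := h.pos_pos
  rw [Network.amount, Network.amount, Nat.sub_add_cancel h1,
    Finset.sum_eq_sum_Ico_succ_bot h.pos_lt, h.self, h.next_eq]
  omega

theorem lockTime_pred (b : Bool) : S.net.lockTime (ch.party a b) ch.hops (ch.pos - 1) =
    S.net.timelock a (ch.next a) + S.net.lockTime (ch.party a b) ch.hops ch.pos := by
  have h1 := h.pos_pos
  rw [Network.lockTime, Network.lockTime, Nat.sub_add_cancel h1,
    Finset.sum_eq_sum_Ico_succ_bot h.pos_lt, h.self, h.next_eq]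

end ValidChoice

/-- The view of the adversary in terms of the ciphertext `C` for the next hop. -/
def viewOf (a : Fin n) (ch : Choice n) (b : Bool) (κ : ℕ) (l : ℕ → S.hom.Dom κ) (C : Data) : Data :=
  Data.ofList [S.condPayment κ (ch.party a b) ch.hops ch.value l (ch.pos - 1),
    S.layer κ (ch.party a b) ch.hops ch.value l ch.remaining C,
    S.hom.encDom κ (S.witness κ l ch.pos)]

/-- Once the shares and the ciphertext are given, nothing in the view depends on the bit. -/
theorem ValidChoice.viewOf_eq {S : SyncPCN n} {a : Fin n} {ch : Choice n}
    (h : S.ValidChoice a ch) (b : Bool) (κ : ℕ) (l : ℕ → S.hom.Dom κ) (C : Data) :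
    S.viewOf a ch b κ l C = S.viewOf a ch false κ l C := by
  simp only [viewOf, layer, condPayment, h.hops_sub, h.amount_pred b, h.amount_pred false,
    h.lockTime_pred b, h.lockTime_pred false, h.amount_pos b, h.lockTime_pos b, h.next_eq b,
    h.next_eq false]

theorem ValidChoice.intermediaryView_eq {S : SyncPCN n} {a : Fin n} {ch : Choice n}
    (h : S.ValidChoice a ch) (b : Bool) (κ : ℕ) (pk : Fin n → Data) :
    S.intermediaryView κ pk (ch.party a b) ch.hops ch.value ch.pos =
      (iid (S.hom.rand κ) 0 ch.hops).bind fun l =>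
        (S.payload κ pk (ch.party a b) ch.hops ch.value l ch.remaining).bind fun M =>
          (S.pke.encrypt (pk (ch.next a)) M).bind fun C =>
            PMF.pure (S.viewOf a ch false κ l C) := by
  simp only [← h.viewOf_eq b]
  simp only [intermediaryView, Bind.bind, Pure.pure, h.remaining_add, payload_succ, PMF.bind_bind,
    PMF.pure_bind, h.hops_sub, h.next_eq]
  rfl

/-! ### The reduction -/

/-- The keys of all parties, where the public key of `u` is replaced by `pk`. -/
def plantKey (ks : ℕ → Data × Data) (u : Fin n) (pk : Data) : Fin n → Data × Data :=
  -- The secret key `leaf` is a dummy that is never read when `u ≠ a`.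
  fun w => Function.update ks u (pk, Data.leaf) w

/-- The law of the output of the first stage of the reduction. -/
def reductionChoose (a : Fin n) (A : Adversary) (ch : Choice n) (κ : ℕ) (pk : Data) : PMF Data :=
  (iid (S.pke.keyGen κ) (Data.leaf, Data.leaf) n).bind fun ks =>
    (A.choose.run (advInput κ a (plantKey ks (ch.next a) pk))).bind fun o =>
      if (Data.ofBool (decide (o.fst = ch.encode))).toBool then
        -- One vector of shares serves both payloads and, through the state, also the view built
        -- later.
        (iid (S.hom.rand κ) 0 ch.hops).bind fun l =>
          (S.payload κ (fun w => (plantKey ks (ch.next a) pk w).1) (ch.party a false) ch.hops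
            ch.value l ch.remaining).bind fun M₀ =>
          (S.payload κ (fun w => (plantKey ks (ch.next a) pk w).1) (ch.party a true) ch.hops
            ch.value l ch.remaining).bind fun M₁ =>
          PMF.pure (Data.node (Data.node M₀ M₁)
            (Data.node (Data.unary κ) (Data.node o.snd (encodeVec (S.hom.encDom κ) l ch.hops))))
      -- Equal messages keep the attack admissible. The state `leaf` differs from every genuine
      -- state, which is a node, and tells the second stage to toss a coin.
      else PMF.pure (Data.node (Data.node Data.leaf Data.leaf) Data.leaf)

theorem efficient_rand {α : Type} {e : α → Data} {κ : α → ℕ}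
    (hκ : EfficientFun e fun x => Data.unary (κ x)) :
    Efficient e fun x => (S.hom.rand (κ x)).map (S.hom.encDom (κ x)) :=
  (hκ.run S.hom.randProg_polyTime).congr fun _ => S.hom.randProg_run _

theorem efficient_reductionChoose {a : Fin n} {A : Adversary} (hA : A.PPT) {ch : Choice n}
    (h : S.ValidChoice a ch) :
    Efficient (fun p : ℕ × Data => Data.node (Data.unary p.1) p.2)
      fun p => S.reductionChoose a A ch p.1 p.2 := by
  have hκ : EfficientFun (fun p : ℕ × Data => Data.node (Data.unary p.1) p.2)
      fun p => Data.unary p.1 := efficientFun_self.fst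
  have hpk : EfficientFun (fun p : ℕ × Data => Data.node (Data.unary p.1) p.2)
      fun p => p.2 := efficientFun_self.snd
  refine Efficient.bind (Efficient.iid (S.pke.efficient_keyGen hκ) _ n) ?_
  have hks := efficientFun_extend_fst (e := fun p : ℕ × Data => Data.node (Data.unary p.1) p.2)
    (e' := fun _ (ks : ℕ → Data × Data) =>
      encodeVec (fun p : Data × Data => Data.node p.1 p.2) ks n)
  -- Each bind enlarges the context by the sampled item; the facts still needed are carried over to
  -- the new encodings `e₁`, `e₂`, `e₃`.
  replace hκ := hκ.extend (e' := fun _ (ks : ℕ → Data × Data) =>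
      encodeVec (fun p : Data × Data => Data.node p.1 p.2) ks n)
  replace hpk := hpk.extend (e' := fun _ (ks : ℕ → Data × Data) =>
      encodeVec (fun p : Data × Data => Data.node p.1 p.2) ks n)
  set e₁ := extend (fun p : ℕ × Data => Data.node (Data.unary p.1) p.2)
    fun _ (ks : ℕ → Data × Data) =>
      encodeVec (fun p : Data × Data => Data.node p.1 p.2) ks n
  have hkey : ∀ w : Fin n, EfficientFun e₁ fun z => Data.node (z.2 w).1 (z.2 w).2 := fun w =>
    EfficientFun.entry (e' := fun _ (p : Data × Data) => Data.node p.1 p.2)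
      (f := fun z : Σ _ : ℕ × Data, (ℕ → Data × Data) => z.2) hks w.2
  have hpks : ∀ w : Fin n, EfficientFun e₁ fun z => (plantKey z.2 (ch.next a) z.1.2 w).1 := by
    intro w
    by_cases hw : w = ch.next a
    · subst hw
      simpa only [plantKey, Function.update_self] using hpk
    · simp only [plantKey, Function.update_of_ne (Fin.val_ne_of_ne hw)]
      exact (hkey w).fst
  have hsk : EfficientFun e₁ fun z => (plantKey z.2 (ch.next a) z.1.2 a).2 := by
    simp only [plantKey, Function.update_of_ne (Fin.val_ne_of_ne h.next_ne.symm)]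
    exact (hkey a).snd
  refine Efficient.bindData ((efficient_advInput a hκ hpks hsk).run hA.1) ?_
  have ho : EfficientFun (extend e₁ fun _ (y : Data) => y) fun z => z.2 := efficientFun_extend_fst
  replace hκ := hκ.extend (e' := fun _ (y : Data) => y)
  replace hpks := fun w => (hpks w).extend (e' := fun _ (y : Data) => y)
  set e₂ := extend e₁ fun _ (y : Data) => y
  refine (ho.fst.eq (efficientFun_const _)).ite ?_ (efficientFun_const _)
  refine Efficient.bind (Efficient.iid (S.efficient_rand hκ) _ ch.hops) ?_
  have hv := efficientFun_extend_fst (e := e₂)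
    (e' := fun z l => encodeVec (S.hom.encDom z.1.1.1) l ch.hops)
  replace hκ := hκ.extend (e' := fun z l => encodeVec (S.hom.encDom z.1.1.1) l ch.hops)
  replace ho := ho.extend (e' := fun z l => encodeVec (S.hom.encDom z.1.1.1) l ch.hops)
  replace hpks := fun w =>
    (hpks w).extend (e' := fun z l => encodeVec (S.hom.encDom z.1.1.1) l ch.hops)
  set e₃ := extend e₂ fun z l => encodeVec (S.hom.encDom z.1.1.1) l ch.hops
  have hl : ∀ j < ch.hops, EfficientFun e₃ fun z => S.hom.encDom z.1.1.1.1 (z.2 j) :=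
    fun j hj => EfficientFun.entry (e := e₃) (β := fun z => S.hom.Dom z.1.1.1.1) (f := fun z => z.2)
      (e' := fun z => S.hom.encDom z.1.1.1.1) hv hj
  have hk : 0 < ch.hops := (Nat.zero_le _).trans_lt h.pos_lt
  refine Efficient.bindData (S.efficient_payload hκ hpks hl _ _ hk _) ?_
  refine Efficient.bindData (Efficient.extend (S.efficient_payload hκ hpks hl _ _ hk _)) ?_
  exact (EfficientFun.node (efficientFun_extend_fst.extend) efficientFun_extend_fst).node
    (hκ.extend.extend.node (ho.snd.extend.extend.node hv.extend.extend))

/-- The second stage has to assemble the view without knowing the bit; the view at `false` serves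
for both bits. -/
theorem exists_reductionGuess {a : Fin n} {A : Adversary} (hA : A.PPT) {ch : Choice n}
    (h : S.ValidChoice a ch) :
    ∃ c : Prog Empty, c.PolyTime ∧
      (∀ (κ : ℕ) (s : Data) (l : ℕ → S.hom.Dom κ) (C : Data),
        c.run (Data.node (Data.node (Data.unary κ)
          (Data.node s (encodeVec (S.hom.encDom κ) l ch.hops))) C) =
        A.guess.run (Data.node s (S.viewOf a ch false κ l C))) ∧
      ∀ C, c.run (Data.node Data.leaf C) = coin.bind fun b => PMF.pure (Data.ofBool b) := by
  let e : (Σ κ, (Data × (ℕ → S.hom.Dom κ)) × Data) → Data := fun z =>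
    Data.node (Data.node (Data.unary z.1)
      (Data.node z.2.1.1 (encodeVec (S.hom.encDom z.1) z.2.1.2 ch.hops))) z.2.2
  have hκ : EfficientFun e fun z => Data.unary z.1 := efficientFun_self.fst.fst
  have hs : EfficientFun e fun z => z.2.1.1 := efficientFun_self.fst.snd.fst
  have hC : EfficientFun e fun z => z.2.2 := efficientFun_self.snd
  have hl : ∀ j < ch.hops, EfficientFun e fun z => S.hom.encDom z.1 (z.2.1.2 j) := fun j hj =>
    EfficientFun.entry (e := e) (β := fun z => S.hom.Dom z.1) (f := fun z => z.2.1.2)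
      (e' := fun z => S.hom.encDom z.1) efficientFun_self.fst.snd.snd hj
  have hlt := h.pos_lt
  have hview : EfficientFun e fun z => S.viewOf a ch false z.1 z.2.1.2 z.2.2 :=
    (S.efficient_condPayment hκ hl _ _ (by omega)).node
      ((S.efficient_layer hκ hl _ _ (by omega) _ hC).node
        ((S.efficient_witness hκ hl hlt).node (efficientFun_const _)))
  obtain ⟨c, hc, hrun⟩ := (hs.node hview).run hA.2
  -- The test reads the state as a truth value: a node runs `c`, the marker `leaf` tosses the coin.
  refine ⟨Prog.ite .fst c .coin, Prog.polyTime_fst.ite hc Prog.polyTime_coin,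
    fun κ s l C => ?_, fun C => ?_⟩
  · rw [Prog.run_ite, Prog.run_fst, PMF.pure_bind]
    exact hrun ⟨κ, (s, l), C⟩
  · rw [Prog.run_ite, Prog.run_fst, PMF.pure_bind]
    exact Prog.run_coin _

/-! ### The games -/

/-- The keys of all parties and the output of the first stage of the adversary. -/
def firstStage (a : Fin n) (A : Adversary) (κ : ℕ) : PMF ((Fin n → Data × Data) × Data) :=
  (iid (S.pke.keyGen κ) (Data.leaf, Data.leaf) n).bind fun ks =>
    (A.choose.run (advInput κ a fun w : Fin n => ks w)).bind fun o =>
      PMF.pure (fun w : Fin n => ks w, o)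

/-- The game after the first stage of the adversary. -/
def secondStage (a : Fin n) (A : Adversary) (κ : ℕ) (z : (Fin n → Data × Data) × Data) :
    PMF Bool :=
  coin.bind fun b => (S.gameView κ a (fun u => (z.1 u).1) b z.2.fst).bind fun view =>
    (A.guess.run (Data.node z.2.snd view)).bind fun g => PMF.pure (decide (g.toBool = b))

theorem endpointGame_eq (a : Fin n) (A : Adversary) (κ : ℕ) :
    S.endpointGame a A κ = (S.firstStage a A κ).bind (S.secondStage a A κ) := by
  simp only [firstStage, PMF.bind_bind, PMF.pure_bind]
  rfl

/-- A guess of the challenge bit by a coin toss. -/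
def blindGuess (pk : Data) : PMF Bool :=
  coin.bind fun b => (S.pke.encrypt pk Data.leaf).bind fun _ => coin.bind fun g =>
    PMF.pure (decide (g = b))

theorem plantKey_fst (ks : ℕ → Data × Data) (u : Fin n) (x : Data × Data) :
    (fun w : Fin n => (plantKey ks u x.1 w).1) =
      fun w : Fin n => (Function.update ks u x w).1 := by
  funext w
  by_cases hw : (w : ℕ) = u
  · simp [plantKey, hw]
  · simp [plantKey, Function.update_of_ne hw]

/-- Planting only the public key or the complete pair differs in the secret key of `u` alone, which
`a` does not receive. -/
theorem advInput_plantKey (κ : ℕ) {a u : Fin n} (hu : u ≠ a) (ks : ℕ → Data × Data)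
    (x : Data × Data) :
    advInput κ a (plantKey ks u x.1) = advInput κ a fun w : Fin n => Function.update ks u x w := by
  have h := plantKey_fst ks u x
  unfold advInput
  rw [h]
  simp only [plantKey, Function.update_of_ne (Fin.val_ne_of_ne hu.symm)]

-- The attacker draws all `n` key pairs and replaces one by the challenge pair; by `iid_resample`
-- the keys then have the law of honest keys.
open Classical in
theorem ccaGame_reduction {a : Fin n} {A : Adversary} {ch : Choice n} (h : S.ValidChoice a ch)
    {B : PKE.Adversary} (κ : ℕ)
    (hchoose : ∀ (O : Unit → Data → PMF Data) (pk : Data),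
      B.choose.runWith O (Data.node (Data.unary κ) pk) = S.reductionChoose a A ch κ pk)
    (hguess : ∀ (O : Unit → Data → PMF Data) (s : Data) (l : ℕ → S.hom.Dom κ) (C : Data),
      B.guess.runWith O (Data.node (Data.node (Data.unary κ)
          (Data.node s (encodeVec (S.hom.encDom κ) l ch.hops))) C) =
        A.guess.run (Data.node s (S.viewOf a ch false κ l C)))
    (hblind : ∀ (O : Unit → Data → PMF Data) (C : Data),
      B.guess.runWith O (Data.node Data.leaf C) = coin.bind fun b => PMF.pure (Data.ofBool b)) :
    S.pke.ccaGame B κ = (S.firstStage a A κ).bind fun z =>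
      if z.2.fst = ch.encode then S.secondStage a A κ z
      else S.blindGuess (z.1 (ch.next a)).1 := by
  simp only [PKE.ccaGame, Bind.bind, Pure.pure, hchoose, firstStage]
  rw [iid_resample _ _ (ch.next a).2]
  simp only [PMF.bind_bind, PMF.pure_bind, reductionChoose]
  congr 1; funext x; congr 1; funext ks
  rw [advInput_plantKey κ h.next_ne]
  congr 1; funext o
  have hpk := plantKey_fst ks (ch.next a) x
  by_cases ho : o.fst = ch.encode
  · rw [if_pos ho, if_pos (by simp [ho])]
    simp only [PMF.bind_bind, PMF.pure_bind, Data.fst_node, Data.snd_node, hguess, hpk,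
      secondStage, gameView, ho, Choice.decode_encode, h.intermediaryView_eq, Function.update_self]
    -- The privacy game draws the bit before the shares, the attack after them.
    rw [PMF.bind_comm]
    congr 1; funext l
    refine (bind_bind_coin _ _ fun b M => (S.pke.encrypt x.1 M).bind fun C =>
      (A.guess.run (Data.node o.snd (S.viewOf a ch false κ l C))).bind fun g =>
        PMF.pure (decide (g.toBool = b))).trans ?_
    congr 1; funext b
    cases b <;> rfl
  · rw [if_neg ho, if_neg (by simp [ho])]
    simp only [PMF.pure_bind, Data.fst_node, Data.snd_node, hblind, PMF.bind_bind, ite_self,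
      Function.update_self, blindGuess, Data.toBool_ofBool]

/-- Both plaintexts are payloads of a party `remaining` hops from its receiver, so padding gives
them the same length. -/
theorem equalLength_reduction (hpad : S.PaddingSuffices) {a : Fin n} {A : Adversary}
    {ch : Choice n} (h : S.ValidChoice a ch) {B : PKE.Adversary}
    (hchoose : ∀ (O : Unit → Data → PMF Data) (κ : ℕ) (pk : Data),
      B.choose.runWith O (Data.node (Data.unary κ) pk) = S.reductionChoose a A ch κ pk) :
    B.EqualLength S.pke := by
  intro κ k hk o ho
  rw [hchoose, reductionChoose] at ho
  obtain ⟨ks, hks, ho⟩ := (PMF.mem_support_bind_iff _ _ _).1 ho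
  obtain ⟨o', -, ho⟩ := (PMF.mem_support_bind_iff _ _ _).1 ho
  -- The padding hypothesis concerns honestly generated keys, so the dummy pair is replaced by the
  -- complete challenge pair.
  have hkeys : ∀ w : Fin n, Function.update ks (ch.next a) k w ∈ (S.pke.keyGen κ).support := by
    intro w
    by_cases hw : (w : ℕ) = ch.next a
    · rwa [hw, Function.update_self]
    · rw [Function.update_of_ne hw]
      exact mem_support_of_mem_support_iid hks w.2
  have hpk : (fun w : Fin n => (plantKey ks (ch.next a) k.1 w).1) =
      fun w : Fin n => (Function.update ks (ch.next a) k w).1 := plantKey_fst _ _ _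
  rw [hpk] at ho
  have hlt := h.pos_lt
  have hr : ch.remaining < ch.hops := by unfold Choice.remaining; omega
  split_ifs at ho
  · obtain ⟨l, hl, ho⟩ := (PMF.mem_support_bind_iff _ _ _).1 ho
    obtain ⟨M₀, h₀, ho⟩ := (PMF.mem_support_bind_iff _ _ _).1 ho
    obtain ⟨M₁, h₁, ho⟩ := (PMF.mem_support_bind_iff _ _ _).1 ho
    obtain rfl := (PMF.mem_support_pure_iff _ _).1 ho
    have hl' : ∀ j < ch.hops, l j ∈ (S.hom.rand κ).support :=
      fun j hj => mem_support_of_mem_support_iid hl hj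
    have hsize := fun b => hpad κ (fun w : Fin n => Function.update ks (ch.next a) k w) _ _ _ l
      hkeys (h.payment b) hl' _ hr
    exact (hsize false M₀ h₀).trans (hsize true M₁ h₁).symm
  · obtain rfl := (PMF.mem_support_pure_iff _ _).1 ho
    rfl

/-- The attacker is lifted from programs without oracle, so it makes no decryption queries. -/
theorem exists_reduction (hpad : S.PaddingSuffices) {a : Fin n} {A : Adversary} (hA : A.PPT)
    {ch : Choice n} (h : S.ValidChoice a ch) :
    ∃ B : PKE.Adversary, B.PPT S.pke ∧ B.EqualLength S.pke ∧ ∀ κ,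
      S.pke.ccaGame B κ = (S.firstStage a A κ).bind fun z =>
        open Classical in
        if z.2.fst = ch.encode then S.secondStage a A κ z
        else S.blindGuess (z.1 (ch.next a)).1 := by
  obtain ⟨c, hc, hchoose⟩ := S.efficient_reductionChoose hA h
  obtain ⟨g, hg, hguess, hblind⟩ := S.exists_reductionGuess hA h
  refine ⟨⟨c.lift, g.lift⟩, ?_, S.equalLength_reduction hpad (A := A) h fun O κ pk => ?_,
    fun κ => S.ccaGame_reduction h κ (fun O pk => ?_) (fun O s l C => ?_) fun O C => ?_⟩
  · obtain ⟨p, hp⟩ := hc.runsWithin_lift (Q := Unit)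
    obtain ⟨q, hq⟩ := hg.runsWithin_lift (Q := Unit)
    refine ⟨p + q, fun κ k _ ct x => ⟨fun o ho => ?_, fun o ho => ?_⟩⟩
    · exact (hp _ κ x o ho).trans (by simp)
    · exact (hq _ κ x o ho).trans (by simp)
  · rw [Prog.runWith_lift]; exact hchoose (κ, pk)
  · rw [Prog.runWith_lift]; exact hchoose (κ, pk)
  · rw [Prog.runWith_lift]; exact hguess κ s l C
  · rw [Prog.runWith_lift]; exact hblind C

/-- The advantage in the endpoint privacy game is the sum, over all choices that the adversary may
make, of the advantages of the corresponding attacks on the encryption scheme. -/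
theorem advantage_eq_sum {a : Fin n} {A : Adversary} (hadm : A.Admissible S a) (κ : ℕ)
    (L : Finset (Choice n)) (hL : ∀ ch, S.ValidChoice a ch → ch ∈ L) :
    (S.endpointGame a A κ true).toReal - 1 / 2 = ∑ ch ∈ L,
      ((((S.firstStage a A κ).bind fun z =>
        open Classical in
        if z.2.fst = ch.encode then S.secondStage a A κ z
        else S.blindGuess (z.1 (ch.next a)).1) true).toReal - 1 / 2) := by
  rw [endpointGame_eq]
  refine sum_advantage _ _ L _ fun z hz => ?_
  obtain ⟨ks, hks, hz⟩ := (PMF.mem_support_bind_iff _ _ _).1 hz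
  obtain ⟨o, ho, hz⟩ := (PMF.mem_support_bind_iff _ _ _).1 hz
  obtain rfl := (PMF.mem_support_pure_iff _ _).1 hz
  obtain ⟨ch, hch, hvalid⟩ := hadm κ _
    (fun u => mem_support_of_mem_support_iid hks u.2) o ho
  refine ⟨ch, hL ch hvalid, if_pos hch, fun ch' _ hne => ?_⟩
  -- An output encodes at most one choice, so every other attacker guesses blindly.
  rw [if_neg fun h' => hne (Choice.encode_injective (h'.symm.trans hch))]
  exact coin_guess_true _

end SyncPCN

end

theorem mainTheorem4 {n : ℕ} (S : SyncPCN n) (hcca : S.pke.INDCCA) (hpad : S.PaddingSuffices) :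
    S.EndpointPrivacy := by
  intro a A hA hadm
  have hfin := S.finite_validChoice a
  -- The index set does not depend on `κ`, so negligibility of the summands suffices.
  simp only [S.advantage_eq_sum hadm _ hfin.toFinset fun ch h => hfin.mem_toFinset.2 h]
  refine Negligible.sum _ fun ch hch => ?_
  obtain ⟨B, hB, hlen, hgame⟩ := S.exists_reduction hpad hA (hfin.mem_toFinset.1 hch)
  simpa only [hgame] using hcca B hB hlen
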